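/- Let $n\ge 0$, let $A\subseteq\{1,\dots,n\}$ be any set of qubits and $B$ its complement, so that the Hilbert space $\mathcal H=(\mathbb C^2)^{\otimes n}$ splits as $\mathcal H_A\otimes\mathcal H_B$ with dimensions $d_A=2^{|A|}$, $d_B=2^{|B|}$ and $d=d_Ad_B=2^n$. For a pure state $\psi=|\psi\rangle\langle\psi|$ on $\mathcal H$ define the linear entanglement entropy $$E_{\rm lin}(\psi)=1-\mathrm{Tr}_A\big[(\mathrm{Tr}_B\,\psi)^2\big]$$ and the linear stabilizer entropy $$M_{\rm lin}(\psi)=1-d\,\mathrm{Tr}\big(Q\,\psi^{\otimes 4}\big),\qquad Q=\frac1{d^2}\sum_{P}P^{\otimes 4},$$ where $P$ runs over the $4^n$ Pauli strings $P\in\{\mathbb 1,X,Y,Z\}^{\otimes n}$. Let $|\psi_0\rangle\in\mathcal H$ be any unit vector, let $U$ be distributed according to the Haar probability measure on the unitary group $U(d)$, and let $\psi_U=U|\psi_0\rangle\langle\psi_0|U^\dagger$ be the resulting Haar-random (uniformly distributed) pure state. Then $E_{\rm lin}(\psi_U)$ and $M_{\rm lin}(\psi_U)$ are square-integrable random variables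 and they are uncorrelated: $$\mathrm{Cov}(E_{\rm lin},M_{\rm lin})=\mathbb E_U[E_{\rm lin}(\psi_U)M_{\rm lin}(\psi_U)]-\mathbb E_U[E_{\rm lin}(\psi_U)]\,\mathbb E_U[M_{\rm lin}(\psi_U)]=0 .$$ -/

import Mathlib

open MeasureTheory ProbabilityTheory

namespace Magic

/-- Labels of the computational basis of a register of qubits indexed by `ι`. -/
abbrev Bits (ι : Type) : Type := ι → Fin 2

/-- The tensor product `⨂ i, A i` of square matrices, in the product basis. -/
def tensorProd {ι κ : Type} [Fintype ι] (A : ι → Matrix κ κ ℂ) : Matrix (ι → κ) (ι → κ) ℂ :=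
  Matrix.of fun x y => ∏ i, A i (x i) (y i)

/-- The `k`-th tensor power `A^{⊗ k}`. -/
def tensorPow {κ : Type} (A : Matrix κ κ ℂ) (k : ℕ) : Matrix (Fin k → κ) (Fin k → κ) ℂ :=
  tensorProd fun _ => A

/-- The one-qubit Pauli matrices `1, X, Y, Z`. -/
noncomputable def pauli : Fin 4 → Matrix (Fin 2) (Fin 2) ℂ :=
  ![1, !![0, 1; 1, 0], !![0, -Complex.I; Complex.I, 0], !![1, 0; 0, -1]]

/-- The Pauli string `P = ⨂ i, pauli (p i)` on `n` qubits. -/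
noncomputable def pauliString {n : ℕ} (p : Fin n → Fin 4) :
    Matrix (Bits (Fin n)) (Bits (Fin n)) ℂ :=
  tensorProd fun i => pauli (p i)

/-- The operator `Q = d⁻² ∑_P P^{⊗ 4}`, where `d = 2 ^ n` and `P` runs over the `4 ^ n`
Pauli strings. -/
noncomputable def Q (n : ℕ) :
    Matrix (Fin 4 → Bits (Fin n)) (Fin 4 → Bits (Fin n)) ℂ :=
  (((2 : ℂ) ^ n) ^ 2)⁻¹ • ∑ p : Fin n → Fin 4, tensorPow (pauliString p) 4

/-- The basis label of the whole register that agrees with `a` on the qubits in `A` and with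
`b` on the other qubits. -/
def glue {n : ℕ} (A : Finset (Fin n)) (a : Bits {i // i ∈ A}) (b : Bits {i // i ∉ A}) :
    Bits (Fin n) :=
  fun i => if h : i ∈ A then a ⟨i, h⟩ else b ⟨i, h⟩

/-- The partial trace `Tr_B ρ` over the qubits outside `A`. -/
def reduced {n : ℕ} (A : Finset (Fin n)) (ρ : Matrix (Bits (Fin n)) (Bits (Fin n)) ℂ) :
    Matrix (Bits {i // i ∈ A}) (Bits {i // i ∈ A}) ℂ :=
  Matrix.of fun a a' => ∑ b : Bits {i // i ∉ A}, ρ (glue A a b) (glue A a' b)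

/-- The linear entanglement entropy `1 - Tr ((Tr_B ρ)²)`; the trace is a real number
whenever `ρ` is Hermitian. -/
noncomputable def linEnt {n : ℕ} (A : Finset (Fin n))
    (ρ : Matrix (Bits (Fin n)) (Bits (Fin n)) ℂ) : ℝ :=
  1 - (Matrix.trace (reduced A ρ ^ 2)).re

/-- The linear stabilizer entropy `1 - d Tr (Q ρ^{⊗ 4})`, with `d = 2 ^ n`; the trace is a real
number whenever `ρ` is Hermitian. -/
noncomputable def linMagic {n : ℕ} (ρ : Matrix (Bits (Fin n)) (Bits (Fin n)) ℂ) : ℝ :=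
  1 - (2 : ℝ) ^ n * (Matrix.trace (Q n * tensorPow ρ 4)).re

/-- The unitary group `U(d)`, `d = 2 ^ n`, in the computational basis. -/
abbrev UGroup (n : ℕ) : Type := Matrix.unitaryGroup (Bits (Fin n)) ℂ

/-- The Borel σ-algebra of the unitary group. -/
noncomputable instance instMeasurableSpaceUGroup (n : ℕ) : MeasurableSpace (UGroup n) := borel _

instance instBorelSpaceUGroup (n : ℕ) : BorelSpace (UGroup n) := ⟨rfl⟩

instance instCompactSpaceUGroup (n : ℕ) : CompactSpace (UGroup n) := by
  rw [← isCompact_univ_iff, Subtype.isCompact_iff, Set.image_univ, Subtype.range_coe]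
  have hK : IsCompact {M : Matrix (Bits (Fin n)) (Bits (Fin n)) ℂ |
      ∀ i j, M i j ∈ Metric.closedBall (0 : ℂ) 1} := by
    have h := isCompact_univ_pi (fun _ : Bits (Fin n) =>
      isCompact_univ_pi (fun _ : Bits (Fin n) => isCompact_closedBall (0 : ℂ) 1))
    have e : {M : Matrix (Bits (Fin n)) (Bits (Fin n)) ℂ |
        ∀ i j, M i j ∈ Metric.closedBall (0 : ℂ) 1} = Set.univ.pi fun _ : Bits (Fin n) =>
          Set.univ.pi fun _ : Bits (Fin n) => Metric.closedBall (0 : ℂ) 1 :=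
      Set.ext fun _ => ⟨fun hM i _ j _ => hM i j, fun hM i j => hM i trivial j trivial⟩
    rw [e]
    exact h
  refine hK.of_isClosed_subset ?_ ?_
  · exact isClosed_unitary
  · intro M hM i j
    rw [mem_closedBall_zero_iff]
    exact entry_norm_bound_of_unitary hM i j

/-- The Haar probability measure `dU` on the unitary group `U(d)`, `d = 2 ^ n`. -/
noncomputable def haarU (n : ℕ) : Measure (UGroup n) :=
  Measure.haarMeasure (⊤ : TopologicalSpace.PositiveCompacts (UGroup n))

/-- The projector `|φ⟩⟨φ|` of the vector `|φ⟩ = U |ψ₀⟩`. -/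
noncomputable def randomState {n : ℕ} (ψ₀ : EuclideanSpace ℂ (Bits (Fin n))) (U : UGroup n) :
    Matrix (Bits (Fin n)) (Bits (Fin n)) ℂ :=
  let φ : Bits (Fin n) → ℂ := U.1.mulVec ψ₀.ofLp
  Matrix.vecMulVec φ (star φ)

end Magic

namespace Magic

/-! Write `w_p` for the squared Pauli expectation `|Tr (P ψ_U)|²`. The swap trick makes `E_lin` an
affine function of the `w_p` with `p` supported on `A` (`linEnt_eq`). `M_lin` is affine in `∑ w_p²`
over all strings (`linMagic_eq`), so it is unchanged by any unitary whose conjugation permutes the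
strings up to phase. It therefore suffices that each `w_p` is uncorrelated with every continuous `g`
having this invariance (`covariance_pauliWeight`).

For anticommuting strings `P`, `Q` the Clifford unitary `(P + Q)/√2` exchanges them, and any two
non-identity strings are linked by a third anticommuting with both. Left invariance of Haar measure
then makes `𝔼[w_p g]` the same for all `p ≠ 0`. Purity gives `∑ w_p = 2^n`, and `w_0 = 1`, so the
sum over `p ≠ 0` is the constant `2^n - 1`. Hence `𝔼[w_p g]` is a fixed multiple of `𝔼[g]`, and `g =
1` identifies the factor as `𝔼[w_p]`. -/

/-! ### Tensor products of matrices -/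

theorem tensorProd_mul {ι κ : Type} [Fintype ι] [DecidableEq ι] [Fintype κ]
    (A B : ι → Matrix κ κ ℂ) :
    tensorProd A * tensorProd B = tensorProd fun i => A i * B i := by
  ext x y
  simp only [tensorProd, Matrix.mul_apply, Matrix.of_apply, ← Finset.prod_mul_distrib]
  rw [Finset.prod_univ_sum, Fintype.piFinset_univ]

theorem tensorProd_smul {ι κ : Type} [Fintype ι] (c : ι → ℂ) (A : ι → Matrix κ κ ℂ) :
    (tensorProd fun i => c i • A i) = (∏ i, c i) • tensorProd A := by
  ext x y
  simp [tensorProd, Finset.prod_mul_distrib]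

theorem tensorProd_one {ι κ : Type} [Fintype ι] [DecidableEq κ] [DecidableEq ι] :
    (tensorProd fun _ : ι => (1 : Matrix κ κ ℂ)) = 1 := by
  ext x y
  simp only [tensorProd, Matrix.of_apply, Matrix.one_apply, Finset.prod_ite_zero,
    Finset.prod_const_one, Finset.mem_univ, true_imp_iff, funext_iff]

theorem trace_tensorProd {ι κ : Type} [Fintype ι] [DecidableEq ι] [Fintype κ]
    (A : ι → Matrix κ κ ℂ) : (tensorProd A).trace = ∏ i, (A i).trace := by
  simp only [tensorProd, Matrix.trace, Matrix.diag, Matrix.of_apply]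
  rw [Finset.prod_univ_sum, Fintype.piFinset_univ]

theorem conjTranspose_tensorProd {ι κ : Type} [Fintype ι] (A : ι → Matrix κ κ ℂ) :
    (tensorProd A).conjTranspose = tensorProd fun i => (A i).conjTranspose := by
  ext x y
  simp [tensorProd, Matrix.conjTranspose_apply]

/-! ### Pauli strings modulo phases -/

/-- The commutation sign of two one-qubit Pauli matrices. -/
def pauliSign (a b : Fin 4) : ℤˣ := if a = 0 ∨ b = 0 ∨ a = b then 1 else -1

/-- On the labels 0, 1, 2, 3 of `1, X, Y, Z`, bitwise xor is multiplication modulo phase, so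
commutation signs are multiplicative in it. -/
theorem pauliSign_xor_right (a b c : Fin 4) :
    pauliSign a (b ^^^ c) = pauliSign a b * pauliSign a c := by
  revert a b c; decide

theorem pauliSign_comm (a b : Fin 4) : pauliSign a b = pauliSign b a := by
  revert a b; decide

theorem exists_pauli_mul (a b : Fin 4) :
    ∃ c : ℂ, ‖c‖ = 1 ∧ pauli a * pauli b = c • pauli (a ^^^ b) := by
  have h : ∃ c : ℂ, (c = 1 ∨ c = Complex.I ∨ c = -Complex.I) ∧
      pauli a * pauli b = c • pauli (a ^^^ b) := by
    fin_cases a <;> fin_cases b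
    all_goals first
      | (refine ⟨1, by simp, ?_⟩; ext i j; fin_cases i <;> fin_cases j <;> simp [pauli]; done)
      | (refine ⟨Complex.I, by simp, ?_⟩; ext i j; fin_cases i <;> fin_cases j <;> simp [pauli]; done)
      | (refine ⟨-Complex.I, by simp, ?_⟩; ext i j; fin_cases i <;> fin_cases j <;> simp [pauli])
  obtain ⟨c, hc, h⟩ := h
  refine ⟨c, ?_, h⟩
  rcases hc with rfl | rfl | rfl <;> simp

theorem pauli_mul_comm (a b : Fin 4) :
    pauli a * pauli b = ((pauliSign a b : ℤ) : ℂ) • (pauli b * pauli a) := by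
  fin_cases a <;> fin_cases b <;> ext i j <;> fin_cases i <;> fin_cases j <;>
    simp [pauli, pauliSign]

theorem pauli_mul_self (a : Fin 4) : pauli a * pauli a = 1 := by
  fin_cases a <;> ext i j <;> fin_cases i <;> fin_cases j <;> simp [pauli]

theorem conjTranspose_pauli (a : Fin 4) : (pauli a).conjTranspose = pauli a := by
  fin_cases a <;> ext i j <;> fin_cases i <;> fin_cases j <;> simp [pauli]

theorem sum_pauli_mul_pauli (x y z w : Fin 2) :
    ∑ a, pauli a x y * pauli a z w = if x = w ∧ y = z then 2 else 0 := by
  fin_cases x <;> fin_cases y <;> fin_cases z <;> fin_cases w <;>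
    simp [pauli, Fin.sum_univ_four] <;> norm_num

/-- The commutation sign of two Pauli strings. -/
def stringSign {n : ℕ} (p q : Fin n → Fin 4) : ℤˣ := ∏ i, pauliSign (p i) (q i)

/-- The product of two Pauli strings modulo phases. -/
def stringXor {n : ℕ} (p q : Fin n → Fin 4) : Fin n → Fin 4 := fun i => p i ^^^ q i

variable {n : ℕ}

theorem stringSign_xor_right (p q r : Fin n → Fin 4) :
    stringSign p (stringXor q r) = stringSign p q * stringSign p r := by
  simp [stringSign, stringXor, pauliSign_xor_right, Finset.prod_mul_distrib]

theorem stringSign_comm (p q : Fin n → Fin 4) : stringSign p q = stringSign q p := by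
  simp [stringSign, pauliSign_comm]

theorem stringSign_self (p : Fin n → Fin 4) : stringSign p p = 1 := by
  simp [stringSign, pauliSign]

theorem stringXor_xor_cancel (p q : Fin n → Fin 4) : stringXor (stringXor p q) q = p := by
  funext i
  have h : ∀ a b : Fin 4, a ^^^ b ^^^ b = a := by decide
  exact h _ _

theorem stringXor_xor_cancel_left (p q : Fin n → Fin 4) : stringXor p (stringXor p q) = q := by
  funext i
  have h : ∀ a b : Fin 4, a ^^^ (a ^^^ b) = b := by decide
  exact h _ _

theorem exists_pauliString_mul (p q : Fin n → Fin 4) :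
    ∃ c : ℂ, ‖c‖ = 1 ∧ pauliString p * pauliString q = c • pauliString (stringXor p q) := by
  choose c hc h using fun i => exists_pauli_mul (p i) (q i)
  refine ⟨∏ i, c i, by simp [hc], ?_⟩
  simp only [pauliString, tensorProd_mul, h, tensorProd_smul, stringXor]

theorem pauliString_mul_comm (p q : Fin n → Fin 4) :
    pauliString p * pauliString q =
      ((stringSign p q : ℤ) : ℂ) • (pauliString q * pauliString p) := by
  simp only [pauliString, tensorProd_mul, stringSign, pauli_mul_comm (p _) (q _)]
  rw [tensorProd_smul]
  simp

theorem pauliString_mul_self (p : Fin n → Fin 4) : pauliString p * pauliString p = 1 := by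
  simp only [pauliString, tensorProd_mul, pauli_mul_self, tensorProd_one]

theorem conjTranspose_pauliString (p : Fin n → Fin 4) :
    (pauliString p).conjTranspose = pauliString p := by
  simp only [pauliString, conjTranspose_tensorProd, conjTranspose_pauli]

/-- Any two non-identity Pauli strings anticommute with a common Pauli string. -/
theorem exists_stringSign_eq_neg_one {p q : Fin n → Fin 4} (hp : p ≠ 0) (hq : q ≠ 0) :
    ∃ r, stringSign p r = -1 ∧ stringSign r q = -1 := by
  have h1 : ∀ a : Fin 4, a ≠ 0 → ∃ c, pauliSign a c = -1 := by decide
  have h2 : ∀ a b : Fin 4, a ≠ 0 → b ≠ 0 → ∃ c, pauliSign a c = -1 ∧ pauliSign c b = -1 := by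
    decide
  have hz : ∀ a : Fin 4, pauliSign a 0 = 1 := by decide
  have hz' : ∀ a : Fin 4, pauliSign 0 a = 1 := by decide
  obtain ⟨i, hi⟩ := Function.ne_iff.1 hp
  obtain ⟨j, hj⟩ := Function.ne_iff.1 hq
  have single : ∀ (s : Fin n → Fin 4) (k : Fin n) (c : Fin 4),
      stringSign s (Function.update 0 k c) = pauliSign (s k) c := by
    intro s k c
    rw [stringSign, Finset.prod_eq_single k] <;> simp +contextual [hz]
  -- A single-site string suffices where `p` and `q` are both nontrivial. If `q` is trivial at `i`
  -- and `p` at `j`, one factor at each site flips one sign without affecting the other.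
  by_cases hqi : q i = 0
  · by_cases hpj : p j = 0
    · obtain ⟨c, hc⟩ := h1 _ hi
      obtain ⟨c', hc'⟩ := h1 _ hj
      refine ⟨stringXor (Function.update 0 i c) (Function.update 0 j c'), ?_, ?_⟩
      · rw [stringSign_xor_right, single, single, hc, hpj, hz', mul_one]
      · rw [stringSign_comm, stringSign_xor_right, single, single, hc', hqi, hz', one_mul]
    · obtain ⟨c, hc, hc'⟩ := h2 _ _ hpj hj
      exact ⟨Function.update 0 j c, by rw [single, hc],
        by rw [stringSign_comm, single, pauliSign_comm, hc']⟩
  · obtain ⟨c, hc, hc'⟩ := h2 _ _ hi hqi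
    exact ⟨Function.update 0 i c, by rw [single, hc],
      by rw [stringSign_comm, single, pauliSign_comm, hc']⟩

/-! ### Clifford reflections -/

/-- The permutation of the Pauli strings, modulo signs, given by conjugation with `(P + Q) / √2`. -/
def stringTransvection (p q r : Fin n → Fin 4) : Fin n → Fin 4 :=
  if stringSign p r = stringSign q r then r else stringXor r (stringXor p q)

theorem stringTransvection_left {p q : Fin n → Fin 4} (h : stringSign p q = -1) :
    stringTransvection p q p = q := by
  rw [stringTransvection, stringSign_self, stringSign_comm, h, if_neg (by decide),
    stringXor_xor_cancel_left]

/-- Multiplying `r` by `PQ` flips its signs against both `p` and `q`, so whether they agree is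
preserved, and the second multiplication undoes the first. -/
theorem stringTransvection_involutive {p q : Fin n → Fin 4} (h : stringSign p q = -1) :
    Function.Involutive (stringTransvection p q) := by
  intro r
  by_cases hr : stringSign p r = stringSign q r
  · simp [stringTransvection, hr]
  · have e : stringTransvection p q r = stringXor r (stringXor p q) := if_neg hr
    rw [e, stringTransvection, if_neg, stringXor_xor_cancel]
    simpa [stringSign_xor_right, stringSign_self, stringSign_comm q p, h] using hr

/-- The Clifford unitary `(P + Q) / √2`. -/
noncomputable def reflection (p q : Fin n → Fin 4) : Matrix (Bits (Fin n)) (Bits (Fin n)) ℂ :=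
  ((√2 : ℝ) : ℂ)⁻¹ • (pauliString p + pauliString q)

theorem conjTranspose_reflection (p q : Fin n → Fin 4) :
    (reflection p q).conjTranspose = reflection p q := by
  simp [reflection, Matrix.conjTranspose_smul, conjTranspose_pauliString]

theorem inv_sqrt_two_mul_self : ((√2 : ℝ) : ℂ)⁻¹ * ((√2 : ℝ) : ℂ)⁻¹ = 2⁻¹ := by
  rw [← mul_inv, ← Complex.ofReal_mul, Real.mul_self_sqrt (by norm_num)]
  simp

/-- Moving `R` to the left turns `P + Q` into `s P + t Q`, with `s`, `t` the commutation signs.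
Since `QP = -PQ`, the product `(s P + t Q)(P + Q)` is `(s + t) + (s - t) PQ`: one term vanishes
according to whether `s = t`. -/
theorem exists_reflection_mul_mul {p q : Fin n → Fin 4} (h : stringSign p q = -1)
    (r : Fin n → Fin 4) :
    ∃ c : ℂ, ‖c‖ = 1 ∧ reflection p q * pauliString r * reflection p q =
      c • pauliString (stringTransvection p q r) := by
  have hpq : pauliString q * pauliString p = -(pauliString p * pauliString q) := by
    rw [pauliString_mul_comm p q, h]; simp
  have key : reflection p q * pauliString r * reflection p q = (2 : ℂ)⁻¹ • (pauliString r *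
      ((((stringSign p r : ℤ) : ℂ) + ((stringSign q r : ℤ) : ℂ)) • 1 +
        (((stringSign p r : ℤ) : ℂ) - ((stringSign q r : ℤ) : ℂ)) •
          (pauliString p * pauliString q))) := by
    rw [reflection, smul_mul_assoc, smul_mul_smul_comm, inv_sqrt_two_mul_self, add_mul,
      pauliString_mul_comm p r, pauliString_mul_comm q r]
    congr 1
    simp only [add_mul, mul_add, mul_sub, smul_mul_assoc, mul_assoc, pauliString_mul_self, hpq,
      mul_smul_comm, mul_neg, mul_one, sub_smul, add_smul, smul_neg]
    abel
  rw [key, stringTransvection]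
  have hu : ‖((stringSign p r : ℤ) : ℂ)‖ = 1 := by
    rcases Int.units_eq_one_or (stringSign p r) with h | h <;> simp [h]
  split_ifs with hr
  · refine ⟨_, hu, ?_⟩
    rw [hr, sub_self, zero_smul, add_zero, ← two_mul, mul_smul_comm, mul_one, smul_smul]
    simp
  · obtain ⟨c, hc, e⟩ := exists_pauliString_mul p q
    obtain ⟨c', hc', e'⟩ := exists_pauliString_mul r (stringXor p q)
    refine ⟨((stringSign p r : ℤ) : ℂ) * (c * c'), by rw [norm_mul, norm_mul, hu, hc, hc']; norm_num, ?_⟩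
    have hs : stringSign q r = - stringSign p r := by
      rcases Int.units_eq_one_or (stringSign p r) with h | h <;>
      rcases Int.units_eq_one_or (stringSign q r) with h' | h' <;> simp_all
    rw [hs, e]
    simp only [Units.val_neg, Int.cast_neg, add_neg_cancel, zero_smul, zero_add, mul_smul_comm,
      e', smul_smul]
    congr 1
    ring

theorem reflection_mul_self {p q : Fin n → Fin 4} (h : stringSign p q = -1) :
    reflection p q * reflection p q = 1 := by
  have hpq : pauliString q * pauliString p = -(pauliString p * pauliString q) := by
    rw [pauliString_mul_comm p q, h]; simp
  rw [reflection, smul_mul_smul_comm, inv_sqrt_two_mul_self]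
  simp only [add_mul, mul_add, pauliString_mul_self, hpq]
  rw [show (1 + -(pauliString p * pauliString q) + (pauliString p * pauliString q + 1) :
    Matrix (Bits (Fin n)) (Bits (Fin n)) ℂ) = (2 : ℂ) • 1 by rw [two_smul]; abel, smul_smul]
  simp

theorem reflection_mem_unitaryGroup {p q : Fin n → Fin 4} (h : stringSign p q = -1) :
    reflection p q ∈ Matrix.unitaryGroup (Bits (Fin n)) ℂ := by
  rw [Matrix.mem_unitaryGroup_iff, Matrix.star_eq_conjTranspose, conjTranspose_reflection,
    reflection_mul_self h]

/-! ### The entropies in terms of Pauli weights -/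

/-- The expectation value `Tr (P ρ)` of a Pauli string. -/
noncomputable def pauliExp (p : Fin n → Fin 4) (ρ : Matrix (Bits (Fin n)) (Bits (Fin n)) ℂ) : ℂ :=
  (pauliString p * ρ).trace

/-- The squared modulus of the expectation value of a Pauli string. -/
noncomputable def pauliWeight (p : Fin n → Fin 4)
    (ρ : Matrix (Bits (Fin n)) (Bits (Fin n)) ℂ) : ℝ :=
  ‖pauliExp p ρ‖ ^ 2

theorem pauliExp_sq {ρ : Matrix (Bits (Fin n)) (Bits (Fin n)) ℂ} (hρ : ρ.IsHermitian)
    (p : Fin n → Fin 4) : pauliExp p ρ ^ 2 = (pauliWeight p ρ : ℂ) := by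
  have h : star (pauliExp p ρ) = pauliExp p ρ := by
    rw [pauliExp, ← Matrix.trace_conjTranspose, Matrix.conjTranspose_mul, hρ.eq,
      conjTranspose_pauliString, Matrix.trace_mul_comm]
  rw [pauliWeight, Complex.ofReal_pow, ← Complex.mul_conj', sq]
  congr 1
  exact h.symm

theorem linMagic_eq {ρ : Matrix (Bits (Fin n)) (Bits (Fin n)) ℂ} (hρ : ρ.IsHermitian) :
    linMagic ρ = 1 - ((2 : ℝ) ^ n)⁻¹ * ∑ p, pauliWeight p ρ ^ 2 := by
  have h : ∀ p : Fin n → Fin 4, (tensorPow (pauliString p) 4 * tensorPow ρ 4).trace =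
      ((pauliWeight p ρ ^ 2 : ℝ) : ℂ) := by
    intro p
    rw [tensorPow, tensorPow, tensorProd_mul, trace_tensorProd, Complex.ofReal_pow,
      ← pauliExp_sq hρ, ← pow_mul]
    simp [pauliExp]
  have h' : (Q n * tensorPow ρ 4).trace =
      (((((2 : ℝ) ^ n) ^ 2)⁻¹ * ∑ p, pauliWeight p ρ ^ 2 : ℝ) : ℂ) := by
    rw [Q, smul_mul_assoc, Matrix.trace_smul, Finset.sum_mul, Matrix.trace_sum]
    simp only [h]
    push_cast
    rfl
  rw [linMagic, h', Complex.ofReal_re]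
  field_simp

/-- The Pauli strings that act trivially outside `A`. -/
def stringsOn (A : Finset (Fin n)) : Finset (Fin n → Fin 4) :=
  Fintype.piFinset fun i => if i ∈ A then Finset.univ else {0}

/-- On one qubit `∑ P ⊗ P` is twice the swap. The sum is thus `2^|A|` times the swap of the two
copies on `A`, tensored with the identity elsewhere. -/
theorem sum_stringsOn_mul (A : Finset (Fin n)) (x y z w : Bits (Fin n)) :
    ∑ p ∈ stringsOn A, pauliString p x y * pauliString p z w =
      if (∀ i, if i ∈ A then x i = w i ∧ y i = z i else x i = y i ∧ z i = w i)
        then (2 : ℂ) ^ A.card else 0 := by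
  simp only [pauliString, tensorProd, Matrix.of_apply, ← Finset.prod_mul_distrib]
  rw [stringsOn, ← Finset.prod_univ_sum (fun i => if i ∈ A then Finset.univ else {0})
    fun i a => pauli a (x i) (y i) * pauli a (z i) (w i)]
  have h : ∀ i, (∑ a ∈ (if i ∈ A then Finset.univ else {0} : Finset (Fin 4)),
      pauli a (x i) (y i) * pauli a (z i) (w i)) = (if i ∈ A then (2 : ℂ) else 1) *
        if (if i ∈ A then x i = w i ∧ y i = z i else x i = y i ∧ z i = w i) then 1 else 0 := by
    intro i
    by_cases hi : i ∈ A
    · simp only [hi, if_true, sum_pauli_mul_pauli, mul_ite, mul_one, mul_zero]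
    · simp [hi, pauli, Matrix.one_apply, ← ite_and]
      congr 1
      rw [and_comm]
  simp only [h, Finset.prod_ite_zero, Finset.mem_univ, true_imp_iff, Finset.prod_ite_mem, Finset.univ_inter, Finset.prod_const,
    mul_ite, mul_one, mul_zero]

theorem sum_stringsOn_pauliExp_sq (A : Finset (Fin n))
    (ρ : Matrix (Bits (Fin n)) (Bits (Fin n)) ℂ) :
    ∑ p ∈ stringsOn A, pauliExp p ρ ^ 2 = ∑ x, ∑ y, ∑ z, ∑ w,
      (if (∀ i, if i ∈ A then x i = w i ∧ y i = z i else x i = y i ∧ z i = w i)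
        then (2 : ℂ) ^ A.card else 0) * (ρ y x * ρ w z) := by
  simp only [← sum_stringsOn_mul, Finset.sum_mul]
  have h : ∀ p, pauliExp p ρ ^ 2 = ∑ x, ∑ y, ∑ z, ∑ w,
      pauliString p x y * pauliString p z w * (ρ y x * ρ w z) := by
    intro p
    simp only [pauliExp, Matrix.trace, Matrix.diag, Matrix.mul_apply, sq, Finset.sum_mul,
      Finset.mul_sum]
    refine Finset.sum_congr rfl fun x _ => Finset.sum_congr rfl fun y _ =>
      Finset.sum_congr rfl fun z _ => Finset.sum_congr rfl fun w _ => by ring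
  simp only [h]
  rw [Finset.sum_comm]
  refine Finset.sum_congr rfl fun x _ => ?_
  rw [Finset.sum_comm]
  refine Finset.sum_congr rfl fun y _ => ?_
  rw [Finset.sum_comm]
  refine Finset.sum_congr rfl fun z _ => ?_
  rw [Finset.sum_comm]

theorem sum_eq_sum_glue (A : Finset (Fin n)) (f : Bits (Fin n) → ℂ) :
    ∑ x, f x = ∑ a, ∑ b, f (glue A a b) := by
  rw [← Fintype.sum_prod_type']
  exact (Equiv.sum_comp (Equiv.piEquivPiSubtypeProd (· ∈ A) fun _ => Fin 2).symm f).symm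

theorem glue_condition_iff (A : Finset (Fin n)) (a₁ a₂ a₃ a₄ : Bits {i // i ∈ A})
    (b₁ b₂ b₃ b₄ : Bits {i // i ∉ A}) :
    (∀ i, if i ∈ A then glue A a₁ b₁ i = glue A a₄ b₄ i ∧ glue A a₂ b₂ i = glue A a₃ b₃ i
      else glue A a₁ b₁ i = glue A a₂ b₂ i ∧ glue A a₃ b₃ i = glue A a₄ b₄ i) ↔
      (a₁ = a₄ ∧ a₂ = a₃) ∧ b₁ = b₂ ∧ b₃ = b₄ := by
  constructor
  · intro h
    refine ⟨⟨?_, ?_⟩, ?_, ?_⟩ <;> funext ⟨i, hi⟩ <;> have := h i <;> simp_all [glue]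
  · rintro ⟨⟨rfl, rfl⟩, rfl, rfl⟩ i
    by_cases hi : i ∈ A <;> simp [glue, hi]

theorem sum_stringsOn_pauliExp_sq_eq_trace (A : Finset (Fin n))
    (ρ : Matrix (Bits (Fin n)) (Bits (Fin n)) ℂ) :
    ∑ p ∈ stringsOn A, pauliExp p ρ ^ 2 = 2 ^ A.card * (reduced A ρ ^ 2).trace := by
  rw [sum_stringsOn_pauliExp_sq]
  simp only [sum_eq_sum_glue A, glue_condition_iff, ite_and, ite_mul, zero_mul]
  simp only [Finset.sum_ite_eq, Finset.sum_ite_irrel, Finset.sum_const_zero, Finset.mem_univ,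
    if_true]
  simp only [Matrix.trace, Matrix.diag, sq, Matrix.mul_apply, reduced, Matrix.of_apply,
    Finset.mul_sum, Finset.sum_mul]
  rw [Finset.sum_comm (s := Finset.univ (α := Bits {i // i ∈ A}))
    (t := Finset.univ (α := Bits {i // i ∈ A}))]
  refine Finset.sum_congr rfl fun a _ => ?_
  rw [Finset.sum_comm]
  exact Finset.sum_congr rfl fun a' _ => Finset.sum_comm

theorem linEnt_eq (A : Finset (Fin n)) {ρ : Matrix (Bits (Fin n)) (Bits (Fin n)) ℂ}
    (hρ : ρ.IsHermitian) :
    linEnt A ρ = 1 - ((2 : ℝ) ^ A.card)⁻¹ * ∑ p ∈ stringsOn A, pauliWeight p ρ := by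
  have h := sum_stringsOn_pauliExp_sq_eq_trace A ρ
  simp only [pauliExp_sq hρ] at h
  have h' : (reduced A ρ ^ 2).trace =
      ((((2 : ℝ) ^ A.card)⁻¹ * ∑ p ∈ stringsOn A, pauliWeight p ρ : ℝ) : ℂ) := by
    push_cast
    rw [h]
    field_simp
  rw [linEnt, h', Complex.ofReal_re]

/-- The swap trick with `A` the whole register, where no partial trace remains. -/
theorem sum_pauliExp_sq (ρ : Matrix (Bits (Fin n)) (Bits (Fin n)) ℂ) :
    ∑ p, pauliExp p ρ ^ 2 = 2 ^ n * (ρ * ρ).trace := by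
  have h := sum_stringsOn_pauliExp_sq Finset.univ ρ
  simp only [stringsOn, Finset.mem_univ, if_true, Fintype.piFinset_univ, Finset.card_univ,
    Fintype.card_fin, forall_and, ← funext_iff, ite_and, ite_mul, zero_mul] at h
  rw [h]
  simp only [Finset.sum_ite_eq, Finset.mem_univ, if_true]
  simp only [Matrix.trace, Matrix.diag, Matrix.mul_apply, Finset.mul_sum]
  rw [Finset.sum_comm]

/-! ### Random states -/

variable (ψ₀ : EuclideanSpace ℂ (Bits (Fin n)))

theorem isHermitian_randomState (U : UGroup n) : (randomState ψ₀ U).IsHermitian := by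
  simp [Matrix.IsHermitian, randomState, Matrix.conjTranspose_vecMulVec]

theorem randomState_mul (C U : UGroup n) :
    randomState ψ₀ (C * U) = C.1 * randomState ψ₀ U * C.1.conjTranspose := by
  simp only [randomState]
  rw [Matrix.mul_vecMulVec, Matrix.vecMulVec_mul, Matrix.mulVec_mulVec, ← Matrix.star_mulVec,
    Matrix.mulVec_mulVec]
  rfl

variable {ψ₀}

theorem star_dotProduct_mulVec (hψ₀ : ‖ψ₀‖ = 1) (U : UGroup n) :
    star (U.1.mulVec ψ₀.ofLp) ⬝ᵥ U.1.mulVec ψ₀.ofLp = 1 := by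
  rw [Matrix.star_mulVec, ← Matrix.dotProduct_mulVec, Matrix.mulVec_mulVec,
    ← Matrix.star_eq_conjTranspose, Unitary.coe_star_mul_self, Matrix.one_mulVec, dotProduct_comm,
    ← EuclideanSpace.inner_eq_star_dotProduct, inner_self_eq_norm_sq_to_K, hψ₀]
  simp

theorem trace_randomState (hψ₀ : ‖ψ₀‖ = 1) (U : UGroup n) : (randomState ψ₀ U).trace = 1 := by
  simp only [randomState]
  rw [Matrix.trace_vecMulVec, dotProduct_comm, star_dotProduct_mulVec hψ₀]

theorem trace_randomState_sq (hψ₀ : ‖ψ₀‖ = 1) (U : UGroup n) :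
    (randomState ψ₀ U * randomState ψ₀ U).trace = 1 := by
  simp only [randomState]
  rw [Matrix.vecMulVec_mul_vecMulVec, star_dotProduct_mulVec hψ₀, one_smul,
    Matrix.trace_vecMulVec, dotProduct_comm, star_dotProduct_mulVec hψ₀]

theorem sum_pauliWeight_randomState (hψ₀ : ‖ψ₀‖ = 1) (U : UGroup n) :
    ∑ p, pauliWeight p (randomState ψ₀ U) = 2 ^ n := by
  have h := sum_pauliExp_sq (randomState ψ₀ U)
  simp only [pauliExp_sq (isHermitian_randomState ψ₀ U), trace_randomState_sq hψ₀ U] at h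
  rw [mul_one] at h
  exact_mod_cast h

theorem pauliWeight_zero_randomState (hψ₀ : ‖ψ₀‖ = 1) (U : UGroup n) :
    pauliWeight 0 (randomState ψ₀ U) = 1 := by
  have h : pauliString (0 : Fin n → Fin 4) = 1 := tensorProd_one
  rw [pauliWeight, pauliExp, h, one_mul, trace_randomState hψ₀, norm_one, one_pow]

/-! ### Clifford invariance and Haar averages -/

variable (ψ₀)

/-- Cyclicity of the trace moves the conjugation onto the string; the modulus in `pauliWeight`
absorbs the phase. -/
theorem pauliWeight_reflection_mul {p q : Fin n → Fin 4} (h : stringSign p q = -1)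
    (r : Fin n → Fin 4) (U : UGroup n) :
    pauliWeight r (randomState ψ₀ (⟨reflection p q, reflection_mem_unitaryGroup h⟩ * U)) =
      pauliWeight (stringTransvection p q r) (randomState ψ₀ U) := by
  obtain ⟨c, hc, e⟩ := exists_reflection_mul_mul h r
  rw [pauliWeight, pauliWeight, pauliExp, pauliExp, randomState_mul, conjTranspose_reflection,
    ← mul_assoc, Matrix.trace_mul_comm, ← mul_assoc, ← mul_assoc, e, smul_mul_assoc,
    Matrix.trace_smul, norm_smul, hc, one_mul]

theorem linMagic_reflection_mul {p q : Fin n → Fin 4} (h : stringSign p q = -1) (U : UGroup n) :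
    linMagic (randomState ψ₀ (⟨reflection p q, reflection_mem_unitaryGroup h⟩ * U)) =
      linMagic (randomState ψ₀ U) := by
  simp only [linMagic_eq (isHermitian_randomState ψ₀ _), pauliWeight_reflection_mul ψ₀ h]
  rw [(stringTransvection_involutive h).bijective.sum_comp
    fun r => pauliWeight r (randomState ψ₀ U) ^ 2]

theorem continuous_pauliWeight_randomState (p : Fin n → Fin 4) :
    Continuous fun U : UGroup n => pauliWeight p (randomState ψ₀ U) := by
  unfold pauliWeight pauliExp randomState
  have h : Continuous fun U : UGroup n => U.1.mulVec ψ₀.ofLp :=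
    continuous_subtype_val.matrix_mulVec continuous_const
  exact ((continuous_const.matrix_mul (h.matrix_vecMulVec h.star)).matrix_trace.norm.pow 2)

instance isMulLeftInvariant_haarU : (haarU n).IsMulLeftInvariant := by
  unfold haarU; infer_instance

instance isProbabilityMeasure_haarU : IsProbabilityMeasure (haarU n) :=
  ⟨Measure.haarMeasure_self⟩

theorem memLp_haarU {f : UGroup n → ℝ} (hf : Continuous f) : MemLp f 2 (haarU n) :=
  hf.memLp_of_hasCompactSupport (HasCompactSupport.of_compactSpace f)

theorem integral_pauliWeight_mul_eq {g : UGroup n → ℝ}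
    (hg : ∀ (p q : Fin n → Fin 4) (h : stringSign p q = -1) (U : UGroup n),
      g (⟨reflection p q, reflection_mem_unitaryGroup h⟩ * U) = g U)
    {p q : Fin n → Fin 4} (hp : p ≠ 0) (hq : q ≠ 0) :
    ∫ U, pauliWeight p (randomState ψ₀ U) * g U ∂haarU n =
      ∫ U, pauliWeight q (randomState ψ₀ U) * g U ∂haarU n := by
  have key : ∀ p q : Fin n → Fin 4, stringSign p q = -1 →
      ∫ U, pauliWeight p (randomState ψ₀ U) * g U ∂haarU n =
        ∫ U, pauliWeight q (randomState ψ₀ U) * g U ∂haarU n := by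
    intro p q h
    rw [← integral_mul_left_eq_self (fun U => pauliWeight p (randomState ψ₀ U) * g U)
      ⟨reflection p q, reflection_mem_unitaryGroup h⟩]
    simp only [pauliWeight_reflection_mul ψ₀ h, hg p q h, stringTransvection_left h]
  obtain ⟨r, h, h'⟩ := exists_stringSign_eq_neg_one hp hq
  exact (key p r h).trans (key r q h')

variable {ψ₀}

theorem card_mul_integral_pauliWeight_mul (hψ₀ : ‖ψ₀‖ = 1) {g : UGroup n → ℝ} (hc : Continuous g)
    (hg : ∀ (p q : Fin n → Fin 4) (h : stringSign p q = -1) (U : UGroup n),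
      g (⟨reflection p q, reflection_mem_unitaryGroup h⟩ * U) = g U)
    {p : Fin n → Fin 4} (hp : p ≠ 0) :
    ((Finset.univ.erase (0 : Fin n → Fin 4)).card : ℝ) *
      ∫ U, pauliWeight p (randomState ψ₀ U) * g U ∂haarU n =
        (2 ^ n - 1) * ∫ U, g U ∂haarU n := by
  -- The equal integrals are spread over all `q ≠ 0`, so that the pointwise sum rule applies under a
  -- single integral.
  rw [← nsmul_eq_mul, ← Finset.sum_const, Finset.sum_congr rfl fun q hq =>
    integral_pauliWeight_mul_eq ψ₀ hg hp (Finset.ne_of_mem_erase hq), ← integral_finsetSum,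
    ← integral_const_mul]
  · congr 1
    funext U
    rw [← Finset.sum_mul, ← sum_pauliWeight_randomState hψ₀ U,
      ← Finset.add_sum_erase _ _ (Finset.mem_univ 0), pauliWeight_zero_randomState hψ₀]
    ring
  · intro q _
    exact (memLp_haarU ((continuous_pauliWeight_randomState ψ₀ q).mul hc)).integrable
      one_le_two

theorem covariance_pauliWeight (hψ₀ : ‖ψ₀‖ = 1) {g : UGroup n → ℝ} (hc : Continuous g)
    (hg : ∀ (p q : Fin n → Fin 4) (h : stringSign p q = -1) (U : UGroup n),
      g (⟨reflection p q, reflection_mem_unitaryGroup h⟩ * U) = g U) (p : Fin n → Fin 4) :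
    cov[fun U => pauliWeight p (randomState ψ₀ U), g; haarU n] = 0 := by
  by_cases hp : p = 0
  · simp only [hp, pauliWeight_zero_randomState hψ₀, covariance_const_left]
  have h1 := card_mul_integral_pauliWeight_mul hψ₀ hc hg hp
  have h2 := card_mul_integral_pauliWeight_mul (g := fun _ => 1) hψ₀ continuous_const
    (fun _ _ _ _ => rfl) hp
  simp only [mul_one, integral_const, probReal_univ, smul_eq_mul] at h2
  -- The value `4^n - 1` is not needed, only that it is nonzero, which `p ≠ 0` witnesses.
  have hN : ((Finset.univ.erase (0 : Fin n → Fin 4)).card : ℝ) ≠ 0 :=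
    Nat.cast_ne_zero.2 (Finset.card_ne_zero_of_mem (Finset.mem_erase.2 ⟨hp, Finset.mem_univ p⟩))
  rw [covariance_eq_sub (memLp_haarU (continuous_pauliWeight_randomState ψ₀ p)) (memLp_haarU hc)]
  refine mul_left_cancel₀ hN ?_
  rw [mul_zero, mul_sub, ← mul_assoc, h2]
  exact sub_eq_zero.2 h1

theorem continuous_linEnt_randomState (A : Finset (Fin n)) :
    Continuous fun U : UGroup n => linEnt A (randomState ψ₀ U) := by
  simp only [linEnt_eq A (isHermitian_randomState ψ₀ _)]
  exact continuous_const.sub (continuous_const.mul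
    (continuous_finsetSum _ fun p _ => continuous_pauliWeight_randomState ψ₀ p))

theorem continuous_linMagic_randomState :
    Continuous fun U : UGroup n => linMagic (randomState ψ₀ U) := by
  simp only [linMagic_eq (isHermitian_randomState ψ₀ _)]
  exact continuous_const.sub (continuous_const.mul
    (continuous_finsetSum _ fun p _ => (continuous_pauliWeight_randomState ψ₀ p).pow 2))

end Magic

theorem mainTheorem1 (n : ℕ) (A : Finset (Fin n))
    (ψ₀ : EuclideanSpace ℂ (Magic.Bits (Fin n))) (hψ₀ : ‖ψ₀‖ = 1) :
    MemLp (fun U => Magic.linEnt A (Magic.randomState ψ₀ U)) 2 (Magic.haarU n) ∧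
    MemLp (fun U => Magic.linMagic (Magic.randomState ψ₀ U)) 2 (Magic.haarU n) ∧
    cov[fun U => Magic.linEnt A (Magic.randomState ψ₀ U),
      fun U => Magic.linMagic (Magic.randomState ψ₀ U); Magic.haarU n] = 0 := by
  have hE := Magic.memLp_haarU (Magic.continuous_linEnt_randomState (ψ₀ := ψ₀) A)
  have hM := Magic.memLp_haarU (Magic.continuous_linMagic_randomState (ψ₀ := ψ₀))
  refine ⟨hE, hM, ?_⟩
  have hw : ∀ p, MemLp (fun U => Magic.pauliWeight p (Magic.randomState ψ₀ U)) 2 (Magic.haarU n) :=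
    fun p => Magic.memLp_haarU (Magic.continuous_pauliWeight_randomState ψ₀ p)
  simp only [Magic.linEnt_eq A (Magic.isHermitian_randomState ψ₀ _)]
  -- Linearity in the first argument reduces the claim to one weight at a time; `linMagic` plays the
  -- role of `g`.
  rw [covariance_const_sub_left
      (((memLp_finsetSum _ fun p _ => hw p).integrable one_le_two).const_mul _),
    covariance_const_mul_left, covariance_fun_sum_left' (fun p _ => hw p) hM,
    Finset.sum_eq_zero fun p _ => Magic.covariance_pauliWeight hψ₀
      Magic.continuous_linMagic_randomState
      (fun _ _ h U => Magic.linMagic_reflection_mul ψ₀ h U) p]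
  simp
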